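/- **Setting.** Let $\mathcal C, S, A$ be finite sets of contexts, states and actions ($A\neq\emptyset$) and let $H,T\ge 1$ be integers. The set $S$ is partitioned into layers $S_1,\dots,S_{H+1}$ with $S_1=\{s_1\}$ and $S_{H+1}=\{s_{H+1}\}$. A transition function $P:S\times A\to\Delta_S$ is called layered if for all $h\le H$, $s\in S_h$, $a\in A$ the distribution $P(\cdot|s,a)$ is supported on $S_{h+1}$. Let $\mathcal D$ be a distribution on $\mathcal C$; for each $c\in\mathcal C$ let $P^\star_c$ be a layered transition function and, for each $(s,a)$, let $\mathcal D_{c,s,a}$ be a loss distribution on $[0,1]$ with mean $\ell^\star_c(s,a)$. For a policy $\pi:S\to\Delta_A$ and a transition function $P$, let $q_h(s,a|\pi,P)$ be the probability that the state-action pair of step $h$ is $(s,a)$ when $\pi$ is played in $P$ from $s_1$. Let $\mathcal F$ be a finite class of functions $\mathcal C\times S\times A\to[0,1]$ with $\ell^\star\in\mathcal F$, and let $\mathcal P$ be a finite class of functions $\mathcal C\times S\times A\to\Delta_S$, layered for every context, with $P^\star\in\mathcal P$. **Algorithm.** Fix $\eta\in\mathbb R$ and $\beta_\ell,\beta_P>0$.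 In rounds $t=1,\dots,T$ a context $c_t\sim\mathcal D$ is drawn independently of the past, the policy $\pi^t_{c_t}$ is played for one episode in $P^\star_{c_t}$, and the trajectory $(c_t,s^t_1,a^t_1,\ell^t_1,\dots,s^t_{H+1})$ is observed, where given the visited state-action pairs and the next states the losses $\ell^t_h$ are independent with laws $\mathcal D_{c_t,s^t_h,a^t_h}$. For each $t$, offline oracles return, as deterministic (measurable) functions of the first $t-1$ trajectories, $$\hat f^t\in\arg\min_{f\in\mathcal F}\sum_{i=1}^{t-1}\sum_{h=1}^H\big(f_{c_i}(s^i_h,a^i_h)-\ell^i_h\big)^2,\qquad \hat P^t\in\arg\max_{P\in\mathcal P}\sum_{i=1}^{t-1}\sum_{h=1}^H\log P_{c_i}(s^i_{h+1}|s^i_h,a^i_h)$$ (with $\log 0=-\infty$). For $s\in S_h$, $h\le H$, and $\beta\in\{\beta_\ell,\beta_P\}$ the exploration bonus is $$b^t_\beta(c,s,a)=\min\Big\{1,\frac{\beta/2}{1+\sum_{i=1}^{t-1}q_h(s,a|\pi^i_c,\hat P^t_c)}\Big\}.$$ The policies are given, for every context $c$, by $\pi^1_c(\cdot|s)$ uniform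 on $A$ and $\pi^{t+1}_c(a|s)\propto\pi^t_c(a|s)\exp(-\eta\,\hat Q^t_{c,h}(s,a))$ for $s\in S_h$, $h\le H$, where $\hat V^t_{c,H+1}=0$ and, for $h=H,\dots,1$, $$\hat Q^t_{c,h}(s,a)=\max\Big\{0,\ \hat f^t_c(s,a)-b^t_{\beta_\ell}(c,s,a)-2H\,b^t_{\beta_P}(c,s,a)+\sum_{s'}\hat P^t_c(s'|s,a)\hat V^t_{c,h+1}(s')\Big\},\qquad \hat V^t_{c,h}(s)=\sum_a\pi^t_c(a|s)\hat Q^t_{c,h}(s,a).$$ **Claim.** For every $\delta\in(0,1)$, with probability at least $1-\delta/4$ over the $T$ rounds of interaction, $$\mathbb E_{c\sim\mathcal D}\Big[\sum_{t=2}^T\sum_{h=1}^H\sum_{s\in S_h}\sum_{a\in A}q_h(s,a|\pi^t_c,P^\star_c)\big(b^t_{\beta_\ell}(c,s,a)+2H\,b^t_{\beta_P}(c,s,a)\big)\Big]\le\frac{5184\,T H^7\log(4TH|\mathcal P|/\delta)}{\min\{\beta_P,\beta_\ell\}}+7(\beta_\ell+2H\beta_P)|S||A|\log(T+1),$$ where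 the expectation is over a fresh context $c$ only, the policies and estimates being fixed by the interaction. -/

import Mathlib

/-! # Contextual episodic loop-free MDPs and optimistic policy optimization

Indices start at `0`.  Layer / step `h : Fin H` is the `(h+1)`-st of the `H` decision layers and the
value `Fin.last H` is the terminal layer.  Round index `t : ℕ` is the number of episodes already
completed, so the objects with index `t` are those of the `(t+1)`-st episode.
Probability simplices `Δ_S`, `Δ_A` are `PMF S`, `PMF A`. -/

namespace OPO

open MeasureTheory
open scoped ENNReal

noncomputable section

/-- A stationary stochastic policy `S → Δ_A`. -/
abbrev Policy (S A : Type*) := S → PMF A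

/-- A transition function `S × A → Δ_S`. -/
abbrev Dynamics (S A : Type*) := S → A → PMF S

/-- Transitions out of a decision layer only lead to the next layer. -/
def RespectsLayers {S A : Type*} {H : ℕ} (layer : S → Fin (H + 1)) (P : Dynamics S A) : Prop :=
  ∀ s a s', layer s ≠ Fin.last H → P s a s' ≠ 0 → (layer s' : ℕ) = (layer s : ℕ) + 1

/-- A stochastic contextual MDP with finite context, state and action spaces, horizon `H`, and a
layered loop-free state space shared by all contexts. -/
structure CMDP (C S A : Type*) (H : ℕ) where
  /-- the layer containing each state -/
  layer : S → Fin (H + 1)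
  /-- the unique initial state -/
  start : S
  /-- the unique end state -/
  final : S
  layer_eq_zero_iff : ∀ s, layer s = 0 ↔ s = start
  layer_eq_last_iff : ∀ s, layer s = Fin.last H ↔ s = final
  /-- the distribution of contexts -/
  ctxLaw : PMF C
  /-- the true dynamics of each context -/
  trans : C → Dynamics S A
  trans_layered : ∀ c, RespectsLayers layer (trans c)
  /-- the distribution of the random loss incurred in a state-action pair -/
  lossLaw : C → S → A → Measure ℝ
  lossLaw_prob : ∀ c s a, IsProbabilityMeasure (lossLaw c s a)
  lossLaw_mem : ∀ c s a, lossLaw c s a (Set.Icc 0 1)ᶜ = 0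

/-- The expected loss function of each context. -/
def CMDP.loss {C S A : Type*} {H : ℕ} (M : CMDP C S A H) (c : C) (s : S) (a : A) : ℝ :=
  ∫ x, x ∂(M.lossLaw c s a)

/-- An observed trajectory: context, visited states, played actions, incurred losses. -/
abbrev Episode (C S A : Type*) (H : ℕ) :=
  C × (Fin (H + 1) → S) × (Fin H → A) × (Fin H → ℝ)

namespace Episode

variable {C S A : Type*} {H : ℕ}

/-- the context of the episode -/
def ctx (e : Episode C S A H) : C := e.1

/-- the state visited at each step -/
def state (e : Episode C S A H) : Fin (H + 1) → S := e.2.1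

/-- the action played at each step -/
def action (e : Episode C S A H) : Fin H → A := e.2.2.1

/-- the loss observed at each step -/
def obsLoss (e : Episode C S A H) : Fin H → ℝ := e.2.2.2

end Episode

/-- The law of the trajectory when the context-dependent policy `π` is played for one episode:
the context has law `M.ctxLaw`, the first state is `M.start`, actions are drawn from the policy,
next states from the true dynamics, and, given these, the losses are independent with laws
`M.lossLaw`. -/
def CMDP.episodeLaw {C S A : Type*} {H : ℕ} [Fintype C] [Fintype S] [Fintype A]
    [MeasurableSpace C] [MeasurableSpace S] [MeasurableSpace A]
    (M : CMDP C S A H) (π : C → Policy S A) : Measure (Episode C S A H) :=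
  ∑ c : C, ∑ s : Fin (H + 1) → S, ∑ a : Fin H → A,
    (M.ctxLaw c * PMF.pure M.start (s 0) *
        ∏ h : Fin H, (π c (s h.castSucc) (a h) *
          M.trans c (s h.castSucc) (a h) (s h.succ))) •
      (Measure.pi fun h : Fin H => M.lossLaw c (s h.castSucc) (a h)).map
        (fun l => ((c, s, a, l) : Episode C S A H))

/-- The law of the state-action pair of step `h` when `π` is played from `s₁` in dynamics `P`. -/
def stepLaw {S A : Type*} (s₁ : S) (π : Policy S A) (P : Dynamics S A) : ℕ → PMF (S × A)
  | 0 => (π s₁).map fun a => (s₁, a)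
  | h + 1 => (stepLaw s₁ π P h).bind fun x =>
      (P x.1 x.2).bind fun s' => (π s').map fun a' => (s', a')

/-- The occupancy measure `q_h(s, a ∣ π, P)`. -/
def occ {S A : Type*} (s₁ : S) (h : ℕ) (s : S) (a : A) (π : Policy S A) (P : Dynamics S A) : ℝ :=
  (stepLaw s₁ π P h (s, a)).toReal

/-- The cumulative squared error of a loss function on a dataset. -/
def sqError {C S A : Type*} {H n : ℕ} (D : Fin n → Episode C S A H) (f : C → S → A → ℝ) : ℝ :=
  ∑ i, ∑ h : Fin H,
    (f (D i).ctx ((D i).state h.castSucc) ((D i).action h) - (D i).obsLoss h) ^ 2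

/-- The log-likelihood of dynamics on a dataset, with the convention `log 0 = -∞`. -/
def logLik {C S A : Type*} {H n : ℕ} (D : Fin n → Episode C S A H) (P : C → Dynamics S A) :
    EReal :=
  ∑ i, ∑ h : Fin H,
    ENNReal.log
      (P (D i).ctx ((D i).state h.castSucc) ((D i).action h) ((D i).state h.succ))

/-- An offline least squares regression oracle over the class `F`: a deterministic (measurable)
selection of a minimizer of the squared error. -/
structure LSOracle {C S A : Type*} (H : ℕ)
    [MeasurableSpace C] [MeasurableSpace S] [MeasurableSpace A]
    (F : Finset (C → S → A → ℝ)) where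
  run : ∀ n : ℕ, (Fin n → Episode C S A H) → (C → S → A → ℝ)
  run_mem : ∀ n D, run n D ∈ F
  run_min : ∀ n D, ∀ f ∈ F, sqError D (run n D) ≤ sqError D f
  measurable_run : ∀ n f, MeasurableSet {D | run n D = f}

/-- An offline log loss regression oracle over the class `Pc`: a deterministic (measurable)
selection of a maximizer of the log-likelihood. -/
structure LogLossOracle {C S A : Type*} (H : ℕ)
    [MeasurableSpace C] [MeasurableSpace S] [MeasurableSpace A]
    (Pc : Finset (C → Dynamics S A)) where
  run : ∀ n : ℕ, (Fin n → Episode C S A H) → (C → Dynamics S A)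
  run_mem : ∀ n D, run n D ∈ Pc
  run_max : ∀ n D, ∀ P ∈ Pc, logLik D P ≤ logLik D (run n D)
  measurable_run : ∀ n P, MeasurableSet {D | run n D = P}

theorem expWeight_sum_ne_zero {A : Type*} (p : PMF A) (g : A → ℝ) :
    ∑' a, p a * ENNReal.ofReal (Real.exp (g a)) ≠ 0 := by
  obtain ⟨a, ha⟩ := p.support_nonempty
  intro h
  have h0 := ENNReal.tsum_eq_zero.mp h a
  rcases mul_eq_zero.mp h0 with h1 | h1
  · exact (p.mem_support_iff a).mp ha h1
  · exact absurd (ENNReal.ofReal_eq_zero.mp h1) (not_le.mpr (Real.exp_pos _))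

theorem expWeight_sum_ne_top {A : Type*} [Fintype A] (p : PMF A) (g : A → ℝ) :
    ∑' a, p a * ENNReal.ofReal (Real.exp (g a)) ≠ ∞ := by
  rw [tsum_fintype]
  exact ENNReal.sum_ne_top.mpr fun a _ =>
    ENNReal.mul_ne_top (p.apply_ne_top a) ENNReal.ofReal_ne_top

section Update

variable {S A : Type*} [Fintype S] [Fintype A] {H : ℕ}

/-- The exploration bonus `b_β(s, a)`, from the past policies and the current dynamics estimate
(of one context). -/
def bonusOf (layer : S → Fin (H + 1)) (s₁ : S) (β : ℝ) {k : ℕ} (past : Fin k → Policy S A)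
    (Phat : Dynamics S A) (s : S) (a : A) : ℝ :=
  min 1 ((β / 2) / (1 + ∑ i, occ s₁ (layer s) s a (past i) Phat))

/-- One backup of the truncated optimistic `Q`-function:
`max {0, ℓ̂(s, a) + ∑ s', P̂(s' ∣ s, a) V(s')}`. -/
def backup (lhat : S → A → ℝ) (Phat : Dynamics S A) (V : S → ℝ) (s : S) (a : A) : ℝ :=
  max 0 (lhat s a + ∑ s', (Phat s a s').toReal * V s')

/-- The optimistic value function of `π`; the first argument after `π` is the number of steps left
until the terminal layer. -/
def Vhat (lhat : S → A → ℝ) (Phat : Dynamics S A) (π : Policy S A) : ℕ → S → ℝ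
  | 0, _ => 0
  | n + 1, s => ∑ a, (π s a).toReal * backup lhat Phat (Vhat lhat Phat π n) s a

/-- The optimistic `Q`-function of `π` at a state `s` (in the layer of `s`). -/
def Qhat (layer : S → Fin (H + 1)) (lhat : S → A → ℝ) (Phat : Dynamics S A) (π : Policy S A)
    (s : S) (a : A) : ℝ :=
  backup lhat Phat (Vhat lhat Phat π (H - 1 - (layer s : ℕ))) s a

/-- The distribution proportional to `p a * exp (-η * Q a)`. -/
def expWeights (η : ℝ) (p : PMF A) (Q : A → ℝ) : PMF A :=
  PMF.normalize (fun a => p a * ENNReal.ofReal (Real.exp (-η * Q a)))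
    (expWeight_sum_ne_zero p _) (expWeight_sum_ne_top p _)

/-- The policies computed for one context from the sequences of loss and dynamics estimates of that
context.  The first one is uniform; each next one is the exponential-weights improvement of the
current policy with respect to its optimistic `Q`-function. -/
def policySeq [Nonempty A] (layer : S → Fin (H + 1)) (s₁ : S) (η βl βP : ℝ)
    (fhat : ℕ → S → A → ℝ) (Phat : ℕ → Dynamics S A) : ℕ → Policy S A
  | 0 => fun _ => PMF.uniformOfFintype A
  | k + 1 =>
      let past : Fin k → Policy S A :=
        fun i => policySeq layer s₁ η βl βP fhat Phat i.1
      let cur : Policy S A := policySeq layer s₁ η βl βP fhat Phat k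
      let lhat : S → A → ℝ := fun s a =>
        fhat k s a - (bonusOf layer s₁ βl past (Phat k) s a
          + 2 * (H : ℝ) * bonusOf layer s₁ βP past (Phat k) s a)
      fun s => expWeights η (cur s) (Qhat layer lhat (Phat k) cur s)
termination_by k => k
decreasing_by all_goals omega

end Update

section Algorithm

variable {C S A : Type*} [Fintype C] [Fintype S] [Fintype A] [Nonempty A] {H : ℕ}
  [MeasurableSpace C] [MeasurableSpace S] [MeasurableSpace A]
  {F : Finset (C → S → A → ℝ)} {Pc : Finset (C → Dynamics S A)}

/-- Everything the algorithm is run with: the two oracles, the learning rate and the two bonus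
parameters. -/
structure Params (C S A : Type*) (H : ℕ)
    [MeasurableSpace C] [MeasurableSpace S] [MeasurableSpace A]
    (F : Finset (C → S → A → ℝ)) (Pc : Finset (C → Dynamics S A)) where
  lsOracle : LSOracle H F
  logOracle : LogLossOracle H Pc
  η : ℝ
  βl : ℝ
  βP : ℝ

/-- The loss estimate computed from the first `t` episodes. -/
def Params.fhat (I : Params C S A H F Pc) (σ : ℕ → Episode C S A H) (t : ℕ) : C → S → A → ℝ :=
  I.lsOracle.run t fun i => σ i

/-- The dynamics estimate computed from the first `t` episodes. -/
def Params.Phat (I : Params C S A H F Pc) (σ : ℕ → Episode C S A H) (t : ℕ) : C → Dynamics S A :=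
  I.logOracle.run t fun i => σ i

/-- The context-dependent policy played after `t` completed episodes; it only depends on those. -/
def Params.policy (I : Params C S A H F Pc) (M : CMDP C S A H) (σ : ℕ → Episode C S A H) (t : ℕ)
    (c : C) : Policy S A :=
  policySeq M.layer M.start I.η I.βl I.βP (fun k => I.fhat σ k c) (fun k => I.Phat σ k c) t

/-- The exploration bonus `b^t_β(c, s, a)`. -/
def Params.bonus (I : Params C S A H F Pc) (M : CMDP C S A H) (σ : ℕ → Episode C S A H)
    (β : ℝ) (t : ℕ) (c : C) (s : S) (a : A) : ℝ :=
  bonusOf M.layer M.start β (fun i : Fin t => I.policy M σ i c) (I.Phat σ t c) s a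

/-- `σ 0, …, σ (T - 1)` are the trajectories of `T` rounds of the algorithm in `M`: conditionally on
the trajectories of the previous rounds, the trajectory of a round has the law of an episode of `M`
under the policy which the algorithm computes from these previous trajectories. -/
structure IsRun {Ω : Type*} [MeasurableSpace Ω] (μ : Measure Ω) (M : CMDP C S A H)
    (I : Params C S A H F Pc) (T : ℕ) (σ : ℕ → Ω → Episode C S A H) : Prop where
  measurable : ∀ t, Measurable (σ t)
  law : ∀ t < T, ∀ B : Set (Fin t → Episode C S A H), MeasurableSet B →
    ∀ E : Set (Episode C S A H), MeasurableSet E →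
      μ ({ω | (fun i : Fin t => σ i ω) ∈ B} ∩ {ω | σ t ω ∈ E}) =
        ∫⁻ ω in {ω | (fun i : Fin t => σ i ω) ∈ B},
          M.episodeLaw (I.policy M (fun i => σ i ω) t) E ∂μ

/-- The context-expected cumulative bonus under the executed policies in rounds `2, …, T`. -/
def Params.expectedBonus (I : Params C S A H F Pc) (M : CMDP C S A H) (T : ℕ)
    (σ : ℕ → Episode C S A H) : ℝ :=
  ∑ c : C, (M.ctxLaw c).toReal *
    ∑ t ∈ Finset.Ico 1 T, ∑ h : Fin H, ∑ s with M.layer s = h.castSucc, ∑ a : A,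
      occ M.start h s a (I.policy M σ t c) (M.trans c) *
        (I.bonus M σ I.βl t c s a + 2 * (H : ℝ) * I.bonus M σ I.βP t c s a)

end Algorithm

end

end OPO

/-! The bonus is small where the occupancies under the estimated dynamics are comparable to the true
ones, and maximum likelihood keeps the two path laws close in Hellinger distance on the policies
already played.

Statistics. For fixed `P`, the square root of the likelihood ratio of an episode has conditional
mean `meanAffinity`, the context-averaged Bhattacharyya coefficient r of the path laws. Since r ≤
exp(r - 1), multiplying each factor by exp(1 - r) gives a nonnegative supermartingale, `likProcess`,
of mean at most 1. Markov's inequality and a union bound over rounds and over `Pc` keep it below B =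
4T|Pc|/δ outside an event of probability δ/4. The maximum likelihood estimate has ratio at least 1,
so the past values of 1 - r at this estimate sum to at most log B (`sum_one_sub_meanAffinity_le`).

Bonuses. Squared differences of square roots of occupancies are at most 2(1 - affinity). For one
context, let D be the sum of these bounds over past rounds. If D ≤ β₀/4, with β₀ the smaller bonus
parameter and β₀ ≥ 1, each bonus is at most 2β/(1 + N), N being the true past occupancy, and ∑ q/(1
+ N) is logarithmic in T. If D ≥ β₀/4, the trivial bound 3H² is at most (12H²/β₀)D. Adding both
bounds and averaging over contexts turns D into the quantity controlled by likelihood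
(`expectedBonus_le_of_sum_le`). When β₀ ≤ 1 the trivial bound already suffices. -/

namespace OPO

open MeasureTheory
open scoped ENNReal

noncomputable section

set_option linter.unusedSectionVars false

/-! ### Path laws, occupancy measures and Hellinger affinity -/

section Path

variable {S A : Type*} [Fintype S] [Fintype A]

/-- The probability of the path `s 0, a 0, s 1, …, s n` when `π` is played from `s₁` in `P`. -/
def pathProb (s₁ : S) (π : Policy S A) (P : Dynamics S A) {n : ℕ} (s : Fin (n + 1) → S)
    (a : Fin n → A) : ℝ≥0∞ :=
  PMF.pure s₁ (s 0) *
    ∏ h : Fin n, (π (s h.castSucc) (a h) * P (s h.castSucc) (a h) (s h.succ))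

theorem sum_snoc {X R : Type*} [Fintype X] [AddCommMonoid R] {n : ℕ} (f : (Fin (n + 1) → X) → R) :
    ∑ s, f s = ∑ s : Fin n → X, ∑ x, f (Fin.snoc (α := fun _ => X) s x) := by
  rw [← (Fin.snocEquiv (fun _ : Fin (n + 1) => X)).sum_comp, Fintype.sum_prod_type,
    Finset.sum_comm]
  rfl

theorem pathProb_snoc (s₁ : S) (π : Policy S A) (P : Dynamics S A) {n : ℕ} (s : Fin (n + 1) → S)
    (a : Fin n → A) (x : S) (y : A) :
    pathProb s₁ π P (Fin.snoc (α := fun _ => S) s x) (Fin.snoc (α := fun _ => A) a y) =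
      pathProb s₁ π P s a * (π (s (Fin.last n)) y * P (s (Fin.last n)) y x) := by
  have h0 : (Fin.snoc (α := fun _ => S) s x : Fin (n + 2) → S) 0 = s 0 :=
    Fin.snoc_castSucc (α := fun _ => S) x s 0
  unfold pathProb
  rw [Fin.prod_univ_castSucc, h0, mul_assoc]
  simp only [Fin.snoc_castSucc, Fin.snoc_last, Fin.succ_castSucc, Fin.succ_last]

theorem sum_pmf_eq_one {X : Type*} [Fintype X] (p : PMF X) : ∑ x, p x = 1 := by
  rw [← tsum_fintype (L := .unconditional X)]; exact p.tsum_coe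

/-- The law of the state of step `n`. -/
def stateMarginal (s₁ : S) (π : Policy S A) (P : Dynamics S A) (n : ℕ) (x : S) : ℝ≥0∞ :=
  open Classical in
  ∑ s : Fin (n + 1) → S, ∑ a : Fin n → A,
    pathProb s₁ π P s a * if s (Fin.last n) = x then 1 else 0

theorem stateMarginal_zero (s₁ : S) (π : Policy S A) (P : Dynamics S A) (x : S) :
    stateMarginal s₁ π P 0 x = PMF.pure s₁ x := by
  classical
  unfold stateMarginal pathProb
  rw [← (Equiv.funUnique (Fin 1) S).symm.sum_comp]
  simp

theorem stateMarginal_succ (s₁ : S) (π : Policy S A) (P : Dynamics S A) (n : ℕ) (x : S) :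
    stateMarginal s₁ π P (n + 1) x =
      ∑ z, ∑ y, stateMarginal s₁ π P n z * π z y * P z y x := by
  classical
  unfold stateMarginal
  rw [sum_snoc]
  simp_rw [sum_snoc (X := A), pathProb_snoc, Fin.snoc_last, Finset.sum_mul]
  have hR : ∀ (s : Fin (n + 1) → S) (a : Fin n → A),
      ∑ z, ∑ y, pathProb s₁ π P s a * (if s (Fin.last n) = z then 1 else 0) * π z y * P z y x =
      ∑ y, pathProb s₁ π P s a * (π (s (Fin.last n)) y * P (s (Fin.last n)) y x) := by
    intro s a
    rw [Finset.sum_eq_single (s (Fin.last n))]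
    · simp [mul_assoc]
    · intro z _ hz
      simp [hz.symm]
    · simp
  calc _ = ∑ s : Fin (n + 1) → S, ∑ a : Fin n → A, ∑ y,
        pathProb s₁ π P s a * (π (s (Fin.last n)) y * P (s (Fin.last n)) y x) := by
        refine Finset.sum_congr rfl fun s _ => ?_
        rw [Finset.sum_eq_single x]
        · simp
        · intro z _ hz
          simp [hz]
        · simp
    _ = _ := by
        simp_rw [← hR]
        rw [Finset.sum_congr rfl fun s _ => Finset.sum_comm, Finset.sum_comm]
        refine Finset.sum_congr rfl fun z _ => ?_
        rw [Finset.sum_congr rfl fun s _ => Finset.sum_comm, Finset.sum_comm]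

theorem stepLaw_eq (s₁ : S) (π : Policy S A) (P : Dynamics S A) (n : ℕ) (x : S) (y : A) :
    stepLaw s₁ π P n (x, y) = stateMarginal s₁ π P n x * π x y := by
  classical
  have hmap : ∀ z x y, ((π z).map fun a => (z, a)) (x, y) = if z = x then π x y else 0 := by
    intro z x y
    rw [PMF.map_apply, tsum_fintype]
    by_cases hz : z = x
    · subst hz; simp
    · simp [hz, Ne.symm hz]
  induction n generalizing x y with
  | zero =>
    rw [stepLaw, hmap, stateMarginal_zero, PMF.pure_apply]
    by_cases h : s₁ = x
    · simp [h]
    · simp [h, Ne.symm h]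
  | succ n ih =>
    rw [stepLaw, PMF.bind_apply, tsum_fintype, Fintype.sum_prod_type, stateMarginal_succ,
      Finset.sum_mul]
    refine Finset.sum_congr rfl fun z _ => ?_
    rw [Finset.sum_mul]
    refine Finset.sum_congr rfl fun b _ => ?_
    rw [ih z b, PMF.bind_apply, tsum_fintype]
    simp_rw [hmap]
    simp [mul_assoc]

/-- The last action and the last transition sum out to 1. This consistency of path laws reduces
events about earlier steps to shorter paths. -/
theorem sum_pathProb_comp_init (s₁ : S) (π : Policy S A) (P : Dynamics S A) {n : ℕ}
    (G : (Fin (n + 1) → S) → (Fin n → A) → ℝ≥0∞) :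
    ∑ s : Fin (n + 2) → S, ∑ a : Fin (n + 1) → A,
        pathProb s₁ π P s a * G (fun i => s i.castSucc) (fun i => a i.castSucc) =
      ∑ s : Fin (n + 1) → S, ∑ a : Fin n → A, pathProb s₁ π P s a * G s a := by
  rw [sum_snoc]
  simp_rw [sum_snoc (X := A), pathProb_snoc, Fin.snoc_castSucc]
  refine Finset.sum_congr rfl fun s _ => ?_
  rw [Finset.sum_comm]
  refine Finset.sum_congr rfl fun a _ => ?_
  have : ∀ x y, pathProb s₁ π P s a * (π (s (Fin.last n)) y * P (s (Fin.last n)) y x) * G s a =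
      (pathProb s₁ π P s a * G s a) * (π (s (Fin.last n)) y * P (s (Fin.last n)) y x) := by
    intros; ring
  simp_rw [this, ← Finset.mul_sum]
  rw [Finset.sum_comm]
  simp_rw [← Finset.mul_sum, sum_pmf_eq_one, mul_one, sum_pmf_eq_one, mul_one]

theorem sum_pathProb (s₁ : S) (π : Policy S A) (P : Dynamics S A) (n : ℕ) :
    ∑ s : Fin (n + 1) → S, ∑ a : Fin n → A, pathProb s₁ π P s a = 1 := by
  induction n with
  | zero =>
    unfold pathProb
    rw [← (Equiv.funUnique (Fin 1) S).symm.sum_comp]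
    simpa using sum_pmf_eq_one (PMF.pure s₁)
  | succ n ih =>
    have := sum_pathProb_comp_init s₁ π P (n := n) fun _ _ => 1
    simpa [ih] using this

/-- Realizes every occupancy as a marginal of one path law of full length, so that a single affinity
controls all steps at once. -/
theorem stepLaw_eq_sum_pathProb (s₁ : S) (π : Policy S A) (P : Dynamics S A) [DecidableEq S]
    [DecidableEq A] (n : ℕ) (h : Fin n) (x : S) (y : A) :
    stepLaw s₁ π P h (x, y) = ∑ s : Fin (n + 1) → S, ∑ a : Fin n → A,
      pathProb s₁ π P s a * if s h.castSucc = x ∧ a h = y then 1 else 0 := by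
  induction n with
  | zero => exact h.elim0
  | succ n ih =>
    induction h using Fin.lastCases with
    | cast h =>
      rw [Fin.val_castSucc, ih h, ← sum_pathProb_comp_init]
    | last =>
      rw [Fin.val_last, stepLaw_eq, sum_snoc]
      simp_rw [sum_snoc (X := A), pathProb_snoc, Fin.snoc_castSucc, Fin.snoc_last]
      simp_rw [stateMarginal, Finset.sum_mul]
      refine Finset.sum_congr rfl fun s _ => ?_
      rw [Finset.sum_comm]
      refine Finset.sum_congr rfl fun a _ => ?_
      rw [Finset.sum_comm, Finset.sum_eq_single y]
      · by_cases hs : s (Fin.last n) = x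
        · simp [hs, ← Finset.mul_sum, sum_pmf_eq_one]
        · simp [hs]
      · intro b _ hb
        simp [hb]
      · simp

theorem pathProb_ne_top (s₁ : S) (π : Policy S A) (P : Dynamics S A) {n : ℕ} (s : Fin (n + 1) → S)
    (a : Fin n → A) : pathProb s₁ π P s a ≠ ∞ :=
  ENNReal.mul_ne_top (PMF.apply_ne_top _ _) <| ENNReal.prod_ne_top fun _ _ =>
    ENNReal.mul_ne_top (PMF.apply_ne_top _ _) (PMF.apply_ne_top _ _)

theorem sum_toReal_pathProb (s₁ : S) (π : Policy S A) (P : Dynamics S A) (n : ℕ) :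
    ∑ x : (Fin (n + 1) → S) × (Fin n → A), (pathProb s₁ π P x.1 x.2).toReal = 1 := by
  rw [← ENNReal.toReal_sum fun x _ => pathProb_ne_top s₁ π P x.1 x.2, Fintype.sum_prod_type,
    sum_pathProb, ENNReal.toReal_one]

theorem occ_eq_sum (s₁ : S) (π : Policy S A) (P : Dynamics S A) [DecidableEq S]
    [DecidableEq A] (n : ℕ) (h : Fin n) (x : S) (y : A) :
    occ s₁ h x y π P = ∑ z : (Fin (n + 1) → S) × (Fin n → A) with
      z.1 h.castSucc = x ∧ z.2 h = y, (pathProb s₁ π P z.1 z.2).toReal := by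
  rw [occ, stepLaw_eq_sum_pathProb,
    ← ENNReal.toReal_sum fun x _ => pathProb_ne_top s₁ π P x.1 x.2, Finset.sum_filter,
    Fintype.sum_prod_type]
  simp

theorem occ_nonneg (s₁ : S) (h : ℕ) (s : S) (a : A) (π : Policy S A) (P : Dynamics S A) :
    0 ≤ occ s₁ h s a π P := ENNReal.toReal_nonneg

theorem sum_occ (s₁ : S) (h : ℕ) (π : Policy S A) (P : Dynamics S A) :
    ∑ s, ∑ a, occ s₁ h s a π P = 1 := by
  unfold occ
  rw [← Fintype.sum_prod_type (f := fun x => (stepLaw s₁ π P h x).toReal),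
    ← ENNReal.toReal_sum fun x _ => PMF.apply_ne_top _ _, sum_pmf_eq_one, ENNReal.toReal_one]

theorem occ_le_one (s₁ : S) (h : ℕ) (s : S) (a : A) (π : Policy S A) (P : Dynamics S A) :
    occ s₁ h s a π P ≤ 1 :=
  ENNReal.toReal_le_of_le_ofReal zero_le_one (by simpa using PMF.coe_le_one _ _)

/-- The Bhattacharyya coefficient of the laws of the length-`n` paths of `π` in `P` and `P'`. -/
def affinity (s₁ : S) (n : ℕ) (π : Policy S A) (P P' : Dynamics S A) : ℝ :=
  ∑ z : (Fin (n + 1) → S) × (Fin n → A),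
    √((pathProb s₁ π P z.1 z.2).toReal * (pathProb s₁ π P' z.1 z.2).toReal)

/-- Data processing for the Hellinger distance under the partition into `U` and its complement:
Cauchy-Schwarz on each block bounds the affinity by that of the two-point laws, and the complement's
square is then dropped. -/
theorem sq_sqrt_sum_sub_le {ι : Type*} [Fintype ι] (p q : ι → ℝ) (hp : ∀ i, 0 ≤ p i)
    (hq : ∀ i, 0 ≤ q i) (hp1 : ∑ i, p i = 1) (hq1 : ∑ i, q i = 1) (U : ι → Prop)
    [DecidablePred U] :
    (√(∑ i with U i, p i) - √(∑ i with U i, q i)) ^ 2 ≤ 2 * (1 - ∑ i, √(p i * q i)) := by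
  have hU := Real.sum_sqrt_mul_sqrt_le (Finset.univ.filter U) hp hq
  have hV := Real.sum_sqrt_mul_sqrt_le (Finset.univ.filter fun i => ¬ U i) hp hq
  have e := Finset.sum_filter_add_sum_filter_not Finset.univ U fun i => √(p i * q i)
  have ep := Finset.sum_filter_add_sum_filter_not Finset.univ U p
  have eq := Finset.sum_filter_add_sum_filter_not Finset.univ U q
  simp_rw [Real.sqrt_mul (hp _)] at e ⊢
  rw [hp1] at ep
  rw [hq1] at eq
  have s1 := Real.sq_sqrt (Finset.sum_nonneg fun i (_ : i ∈ Finset.univ.filter U) => hp i)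
  have s2 := Real.sq_sqrt (Finset.sum_nonneg fun i (_ : i ∈ Finset.univ.filter U) => hq i)
  have s3 := Real.sq_sqrt (Finset.sum_nonneg fun i (_ : i ∈ Finset.univ.filter (¬ U ·)) => hp i)
  have s4 := Real.sq_sqrt (Finset.sum_nonneg fun i (_ : i ∈ Finset.univ.filter (¬ U ·)) => hq i)
  nlinarith [sq_nonneg (√(∑ i with ¬ U i, p i) - √(∑ i with ¬ U i, q i))]

theorem sq_sqrt_occ_sub_le (s₁ : S) (n : ℕ) (h : Fin n) (s : S) (a : A) (π : Policy S A)
    (P P' : Dynamics S A) :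
    (√(occ s₁ h s a π P) - √(occ s₁ h s a π P')) ^ 2 ≤ 2 * (1 - affinity s₁ n π P P') := by
  classical
  rw [occ_eq_sum, occ_eq_sum]
  exact sq_sqrt_sum_sub_le _ _ (fun _ => ENNReal.toReal_nonneg) (fun _ => ENNReal.toReal_nonneg)
    (sum_toReal_pathProb s₁ π P n) (sum_toReal_pathProb s₁ π P' n) _

theorem affinity_le_one (s₁ : S) (n : ℕ) (π : Policy S A) (P P' : Dynamics S A) :
    affinity s₁ n π P P' ≤ 1 := by
  -- With the empty event the left side vanishes, leaving 0 ≤ 2(1 - affinity).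
  have := sq_sqrt_sum_sub_le _ _ (fun _ => ENNReal.toReal_nonneg) (fun _ => ENNReal.toReal_nonneg)
    (sum_toReal_pathProb s₁ π P n) (sum_toReal_pathProb s₁ π P' n) fun _ => False
  simp only [Finset.filter_false, Finset.sum_empty, sub_self] at this
  unfold affinity
  nlinarith

/-- Reverse triangle inequality in ℓ² for the vectors of square roots; passes from single rounds to
cumulative occupancies. -/
theorem sq_sqrt_sum_sub_sqrt_sum_le {ι : Type*} (I : Finset ι) (p q : ι → ℝ) (hp : ∀ i, 0 ≤ p i)
    (hq : ∀ i, 0 ≤ q i) :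
    (√(∑ i ∈ I, p i) - √(∑ i ∈ I, q i)) ^ 2 ≤ ∑ i ∈ I, (√(p i) - √(q i)) ^ 2 := by
  have h := Real.sum_sqrt_mul_sqrt_le I hp hq
  have e : ∀ i, (√(p i) - √(q i)) ^ 2 = p i + q i - 2 * (√(p i) * √(q i)) := fun i => by
    nlinarith [Real.sq_sqrt (hp i), Real.sq_sqrt (hq i)]
  simp_rw [e, Finset.sum_sub_distrib, Finset.sum_add_distrib, ← Finset.mul_sum]
  nlinarith [Real.sq_sqrt (Finset.sum_nonneg fun i (_ : i ∈ I) => hp i),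
    Real.sq_sqrt (Finset.sum_nonneg fun i (_ : i ∈ I) => hq i)]

end Path

/-! ### Logarithmic potential and deterministic bounds on the bonuses -/

theorem sum_div_one_add_sum_le {q : ℕ → ℝ} (h0 : ∀ t, 0 ≤ q t) (h1 : ∀ t, q t ≤ 1) (T : ℕ) :
    ∑ t ∈ Finset.range T, q t / (1 + ∑ i ∈ Finset.range t, q i) ≤
      2 * Real.log (1 + ∑ i ∈ Finset.range T, q i) := by
  induction T with
  | zero => simp
  | succ T ih =>
    rw [Finset.sum_range_succ, Finset.sum_range_succ]
    set N := ∑ i ∈ Finset.range T, q i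
    have hN : 0 ≤ N := Finset.sum_nonneg fun i _ => h0 i
    have hx0 : 0 ≤ q T / (1 + N) := div_nonneg (h0 T) (by linarith)
    have hx1 : q T / (1 + N) ≤ 1 := (div_le_one (by linarith)).2 (by linarith [h1 T])
    -- With x = q/(1 + N), the potential 1 + N grows by the factor 1 + x, and log(1 + x) ≥ 1 - 1/(1
    -- + x) ≥ x/2 because 0 ≤ x ≤ 1.
    have e : 1 + (N + q T) = (1 + N) * (1 + q T / (1 + N)) := by field_simp; ring
    rw [e, Real.log_mul (by positivity) (by positivity)]
    have hl := Real.one_sub_inv_le_log_of_pos (x := 1 + q T / (1 + N)) (by positivity)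
    have h2 : q T / (1 + N) ≤ 2 * (1 - (1 + q T / (1 + N))⁻¹) := by
      set x := q T / (1 + N)
      have : 2 * (1 - (1 + x)⁻¹) - x = x * (1 - x) / (1 + x) := by field_simp; ring
      have : 0 ≤ x * (1 - x) / (1 + x) :=
        div_nonneg (mul_nonneg hx0 (by linarith)) (by linarith)
      linarith
    linarith

section Bonus

variable {S A : Type*} [Fintype S] [Fintype A] {H : ℕ}

theorem bonusOf_le_one (layer : S → Fin (H + 1)) (s₁ : S) (β : ℝ) {k : ℕ}
    (past : Fin k → Policy S A) (Ph : Dynamics S A) (s : S) (a : A) :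
    bonusOf layer s₁ β past Ph s a ≤ 1 := min_le_left _ _

theorem bonusOf_le (layer : S → Fin (H + 1)) (s₁ : S) {β : ℝ} (hβ : 1 ≤ β) {k : ℕ}
    (past : Fin k → Policy S A) (P Ph : Dynamics S A) (s : S) (a : A) (hs : (layer s : ℕ) < H)
    (hD : ∑ i, 2 * (1 - affinity s₁ H (past i) P Ph) ≤ β / 4) :
    bonusOf layer s₁ β past Ph s a ≤
      2 * β / (1 + ∑ i, occ s₁ (layer s) s a (past i) P) := by
  have h1 := sq_sqrt_sum_sub_sqrt_sum_le Finset.univ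
    (fun i => occ s₁ (layer s) s a (past i) P) (fun i => occ s₁ (layer s) s a (past i) Ph)
    (fun _ => occ_nonneg ..) (fun _ => occ_nonneg ..)
  have h2 : ∑ i, (√(occ s₁ (layer s) s a (past i) P) - √(occ s₁ (layer s) s a (past i) Ph)) ^ 2 ≤
      ∑ i, 2 * (1 - affinity s₁ H (past i) P Ph) :=
    Finset.sum_le_sum fun i _ =>
      sq_sqrt_occ_sub_le s₁ H ⟨layer s, hs⟩ s a (past i) P Ph
  have hN : 0 ≤ ∑ i, occ s₁ (layer s) s a (past i) P := Finset.sum_nonneg fun _ _ => occ_nonneg ..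
  have hM : 0 ≤ ∑ i, occ s₁ (layer s) s a (past i) Ph := Finset.sum_nonneg fun _ _ => occ_nonneg ..
  unfold bonusOf
  set N := ∑ i, occ s₁ (layer s) s a (past i) P
  set N' := ∑ i, occ s₁ (layer s) s a (past i) Ph
  -- If N ≤ β, the cap 1 suffices because 1 + N ≤ 2β, which uses β ≥ 1. Otherwise the Hellinger
  -- error is at most N/4, hence √N' ≥ √N/2 and N' ≥ N/4.
  rcases le_total N β with h | h
  · refine (min_le_left _ _).trans ?_
    rw [le_div_iff₀ (by linarith)]
    linarith
  · refine (min_le_right _ _).trans ?_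
    have h3 : (√N - √N') ^ 2 ≤ N / 4 := by linarith
    have h4 : √N / 2 ≤ √N' := by
      have h5 : (√N - √N') ^ 2 ≤ (√N / 2) ^ 2 := by
        rw [div_pow, Real.sq_sqrt hN]; linarith
      have := abs_le_of_sq_le_sq' h5 (by positivity)
      linarith
    have h6 : N / 4 ≤ N' := by
      have := pow_le_pow_left₀ (by positivity) h4 2
      rw [div_pow, Real.sq_sqrt hN, Real.sq_sqrt hM] at this
      linarith
    rw [div_le_div_iff₀ (by linarith) (by linarith)]
    nlinarith

theorem sum_layers_le (layer : S → Fin (H + 1)) {g : S → ℝ} (hg : ∀ s, 0 ≤ g s) :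
    ∑ h : Fin H, ∑ s with layer s = h.castSucc, g s ≤ ∑ s, g s := by
  rw [← Finset.sum_fiberwise Finset.univ layer g, Fin.sum_univ_castSucc]
  exact le_add_of_nonneg_right (Finset.sum_nonneg fun _ _ => hg _)

theorem sum_occ_mul_le (layer : S → Fin (H + 1)) (s₁ : S) (π : Policy S A) (P : Dynamics S A)
    (hH : 1 ≤ H) {b : S → A → ℝ} (hb : ∀ s a, b s a ≤ 1 + 2 * H) :
    ∑ h : Fin H, ∑ s with layer s = h.castSucc, ∑ a, occ s₁ h s a π P * b s a ≤ 3 * (H : ℝ) ^ 2 := by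
  have hH' : (1 : ℝ) ≤ H := by exact_mod_cast hH
  calc _ ≤ ∑ h : Fin H, ∑ s, ∑ a, occ s₁ h s a π P * (1 + 2 * H) := by
        refine Finset.sum_le_sum fun h _ => ?_
        refine (Finset.sum_le_sum fun s _ => Finset.sum_le_sum fun a _ =>
          mul_le_mul_of_nonneg_left (hb s a) (occ_nonneg ..)).trans ?_
        exact Finset.sum_le_sum_of_subset_of_nonneg (Finset.filter_subset _ _) fun s _ _ =>
          Finset.sum_nonneg fun a _ => mul_nonneg (occ_nonneg ..) (by positivity)
    _ = H * (1 + 2 * H) := by simp_rw [← Finset.sum_mul, sum_occ]; simp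
    _ ≤ 3 * (H : ℝ) ^ 2 := by nlinarith

/-- A dichotomy on the accumulated Hellinger error: below β₀/4 the estimated occupancies can be
replaced by true ones, above it the error itself pays for the trivial bound. Both terms are
nonnegative, so their sum covers either case without knowing which contexts are well estimated. -/
theorem sum_occ_mul_bonus_step_le (layer : S → Fin (H + 1)) (s₁ : S) (hH : 1 ≤ H) {β₀ βl βP : ℝ}
    (hβ₀ : 1 ≤ β₀) (hl : β₀ ≤ βl) (hP : β₀ ≤ βP) {k : ℕ} (past : Fin k → Policy S A)
    (π : Policy S A) (P Ph : Dynamics S A) :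
    ∑ h : Fin H, ∑ s with layer s = h.castSucc, ∑ a, occ s₁ h s a π P *
        (bonusOf layer s₁ βl past Ph s a + 2 * (H : ℝ) * bonusOf layer s₁ βP past Ph s a) ≤
      ∑ s, ∑ a, 2 * (βl + 2 * H * βP) *
        (occ s₁ (layer s) s a π P / (1 + ∑ i, occ s₁ (layer s) s a (past i) P)) +
      12 * (H : ℝ) ^ 2 / β₀ * ∑ i, 2 * (1 - affinity s₁ H (past i) P Ph) := by
  have hD0 : 0 ≤ ∑ i, 2 * (1 - affinity s₁ H (past i) P Ph) :=
    Finset.sum_nonneg fun i _ => by linarith [affinity_le_one s₁ H (past i) P Ph]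
  have hY0 : ∀ s, 0 ≤ ∑ a, 2 * (βl + 2 * H * βP) *
      (occ s₁ (layer s) s a π P / (1 + ∑ i, occ s₁ (layer s) s a (past i) P)) := fun s =>
    Finset.sum_nonneg fun a _ => mul_nonneg
      (mul_nonneg zero_le_two (add_nonneg (by linarith)
        (mul_nonneg (by positivity) (by linarith))))
      (div_nonneg (occ_nonneg ..) (add_nonneg zero_le_one
        (Finset.sum_nonneg fun _ _ => occ_nonneg ..)))
  rcases le_total (∑ i, 2 * (1 - affinity s₁ H (past i) P Ph)) (β₀ / 4) with hD | hD
  · refine le_add_of_le_of_nonneg ?_ (mul_nonneg (by positivity) hD0)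
    refine le_trans (Finset.sum_le_sum fun h _ => Finset.sum_le_sum fun s hs => ?_)
      (sum_layers_le layer hY0)
    have hs' : layer s = h.castSucc := (Finset.mem_filter.1 hs).2
    have hsv : (layer s : ℕ) = h := by rw [hs']; rfl
    refine Finset.sum_le_sum fun a _ => ?_
    have h1 := bonusOf_le layer s₁ (hβ₀.trans hl) past P Ph s a (hsv ▸ h.2) (by linarith)
    have h2 := bonusOf_le layer s₁ (hβ₀.trans hP) past P Ph s a (hsv ▸ h.2) (by linarith)
    rw [← hsv]
    have h3 := mul_le_mul_of_nonneg_left (add_le_add h1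
      (mul_le_mul_of_nonneg_left h2 (by positivity : (0 : ℝ) ≤ 2 * H)))
      (occ_nonneg s₁ (layer s) s a π P)
    refine h3.trans (le_of_eq ?_)
    ring
  · refine le_add_of_nonneg_of_le (Finset.sum_nonneg fun s _ => hY0 s) ?_
    refine (sum_occ_mul_le layer s₁ π P hH fun s a => ?_).trans ?_
    · have h1 := bonusOf_le_one layer s₁ βl past Ph s a
      have h2 := mul_le_mul_of_nonneg_left (bonusOf_le_one layer s₁ βP past Ph s a)
        (by positivity : (0 : ℝ) ≤ 2 * H)
      linarith
    -- The coefficient 12 is chosen so that an error of β₀/4 buys exactly the trivial bound 3H².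
    · have : 12 * (H : ℝ) ^ 2 / β₀ * (β₀ / 4) = 3 * (H : ℝ) ^ 2 := by field_simp; ring
      rw [← this]
      exact mul_le_mul_of_nonneg_left hD (by positivity)

theorem sum_occ_mul_bonus_le (layer : S → Fin (H + 1)) (s₁ : S) (hH : 1 ≤ H) {β₀ βl βP : ℝ}
    (hβ₀ : 1 ≤ β₀) (hl : β₀ ≤ βl) (hP : β₀ ≤ βP) (T : ℕ) (π : ℕ → Policy S A)
    (P : Dynamics S A) (Ph : ℕ → Dynamics S A) :
    ∑ t ∈ Finset.Ico 1 T, ∑ h : Fin H, ∑ s with layer s = h.castSucc, ∑ a,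
        occ s₁ h s a (π t) P * (bonusOf layer s₁ βl (fun i : Fin t => π i) (Ph t) s a +
          2 * (H : ℝ) * bonusOf layer s₁ βP (fun i : Fin t => π i) (Ph t) s a) ≤
      4 * (βl + 2 * H * βP) * Fintype.card S * Fintype.card A * Real.log ((T : ℝ) + 1) +
      12 * (H : ℝ) ^ 2 / β₀ *
        ∑ t ∈ Finset.Ico 1 T, ∑ i : Fin t, 2 * (1 - affinity s₁ H (π i) P (Ph t)) := by
  have hc : 0 ≤ 2 * (βl + 2 * H * βP) :=
    mul_nonneg zero_le_two (add_nonneg (by linarith) (mul_nonneg (by positivity) (by linarith)))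
  refine (Finset.sum_le_sum fun t _ => sum_occ_mul_bonus_step_le layer s₁ hH hβ₀ hl hP
    (fun i : Fin t => π i) (π t) P (Ph t)).trans ?_
  rw [Finset.sum_add_distrib, ← Finset.mul_sum]
  refine add_le_add_left ?_ _
  have key : ∀ s a, ∑ t ∈ Finset.Ico 1 T, occ s₁ (layer s) s a (π t) P /
      (1 + ∑ i : Fin t, occ s₁ (layer s) s a (π i) P) ≤ 2 * Real.log ((T : ℝ) + 1) := by
    intro s a
    have h0 := sum_div_one_add_sum_le (q := fun t => occ s₁ (layer s) s a (π t) P)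
      (fun _ => occ_nonneg ..) (fun _ => occ_le_one ..) T
    have hn : ∀ t, 0 ≤ ∑ i ∈ Finset.range t, occ s₁ (layer s) s a (π i) P := fun t =>
      Finset.sum_nonneg fun _ _ => occ_nonneg ..
    have hs : ∑ i ∈ Finset.range T, occ s₁ (layer s) s a (π i) P ≤ T :=
      (Finset.sum_le_sum fun i _ => occ_le_one ..).trans (by simp)
    calc _ ≤ ∑ t ∈ Finset.range T, occ s₁ (layer s) s a (π t) P /
          (1 + ∑ i ∈ Finset.range t, occ s₁ (layer s) s a (π i) P) := by
          simp_rw [Fin.sum_univ_eq_sum_range fun i => occ s₁ (layer s) s a (π i) P]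
          refine Finset.sum_le_sum_of_subset_of_nonneg (fun t ht => ?_) fun t _ _ =>
            div_nonneg (occ_nonneg ..) (by linarith [hn t])
          exact Finset.mem_range.2 (Finset.mem_Ico.1 ht).2
      _ ≤ _ := h0
      _ ≤ _ := mul_le_mul_of_nonneg_left
          (Real.log_le_log (by linarith [hn T]) (by linarith)) zero_le_two
  rw [Finset.sum_comm]
  simp_rw [Finset.sum_comm (s := Finset.Ico 1 T), ← Finset.mul_sum]
  calc _ ≤ 2 * (βl + 2 * H * βP) * ∑ _s : S, ∑ _a : A, 2 * Real.log ((T : ℝ) + 1) :=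
        mul_le_mul_of_nonneg_left
          (Finset.sum_le_sum fun s _ => Finset.sum_le_sum fun a _ => key s a) hc
    _ = _ := by simp; ring

end Bonus

/-! ### Square roots of likelihood ratios -/

section Likelihood

variable {C S A : Type*} [Fintype C] [Fintype S] [Fintype A] {H : ℕ}

/-- The context, states and actions of an episode. -/
def Episode.path (e : Episode C S A H) : C × (Fin (H + 1) → S) × (Fin H → A) :=
  (e.1, e.2.1, e.2.2.1)

/-- The likelihood of the transitions along a path. -/
def lik (P : C → Dynamics S A) (x : C × (Fin (H + 1) → S) × (Fin H → A)) : ℝ≥0∞ :=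
  ∏ h : Fin H, P x.1 (x.2.1 h.castSucc) (x.2.2 h) (x.2.1 h.succ)

theorem lik_ne_top (P : C → Dynamics S A) (x : C × (Fin (H + 1) → S) × (Fin H → A)) :
    lik P x ≠ ∞ := ENNReal.prod_ne_top fun _ _ => PMF.apply_ne_top _ _

theorem log_prod {ι : Type*} (I : Finset ι) (f : ι → ℝ≥0∞) :
    ENNReal.log (∏ i ∈ I, f i) = ∑ i ∈ I, ENNReal.log (f i) := by
  classical
  induction I using Finset.induction_on with
  | empty => simp
  | insert a I ha ih => rw [Finset.prod_insert ha, Finset.sum_insert ha, ENNReal.log_mul_add, ih]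

theorem logLik_eq {n : ℕ} (D : Fin n → Episode C S A H) (P : C → Dynamics S A) :
    logLik D P = ENNReal.log (∏ i, lik P (D i).path) := by
  rw [log_prod]
  exact Finset.sum_congr rfl fun i _ => (log_prod _ _).symm

/-- The square root of the likelihood ratio of `P` to the true dynamics. -/
def sqrtRatio (M : CMDP C S A H) (P : C → Dynamics S A)
    (x : C × (Fin (H + 1) → S) × (Fin H → A)) : ℝ :=
  √((lik P x).toReal / (lik M.trans x).toReal)

/-- The context-averaged Bhattacharyya coefficient of the path laws of `π` in the true dynamics
and in `P`. -/
def meanAffinity (M : CMDP C S A H) (π : C → Policy S A) (P : C → Dynamics S A) : ℝ :=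
  ∑ c, (M.ctxLaw c).toReal * affinity M.start H (π c) (M.trans c) (P c)

theorem pathProb_eq_mul_lik (s₁ : S) (π : C → Policy S A) (P : C → Dynamics S A)
    (x : C × (Fin (H + 1) → S) × (Fin H → A)) :
    pathProb s₁ (π x.1) (P x.1) x.2.1 x.2.2 =
      (PMF.pure s₁ (x.2.1 0) * ∏ h : Fin H, π x.1 (x.2.1 h.castSucc) (x.2.2 h)) * lik P x := by
  rw [pathProb, Finset.prod_mul_distrib, mul_assoc]
  rfl

/-- The policy factors are common to both laws and cancel in the ratio, so p√(p'/p) = √(pp'). A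
vanishing true likelihood makes both sides zero. -/
theorem toReal_pathProb_mul_sqrtRatio (M : CMDP C S A H) (π : C → Policy S A)
    (P : C → Dynamics S A) (x : C × (Fin (H + 1) → S) × (Fin H → A)) :
    (pathProb M.start (π x.1) (M.trans x.1) x.2.1 x.2.2).toReal * sqrtRatio M P x =
      √((pathProb M.start (π x.1) (M.trans x.1) x.2.1 x.2.2).toReal *
        (pathProb M.start (π x.1) (P x.1) x.2.1 x.2.2).toReal) := by
  rw [pathProb_eq_mul_lik, pathProb_eq_mul_lik, sqrtRatio, ENNReal.toReal_mul (b := lik M.trans x),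
    ENNReal.toReal_mul (b := lik P x)]
  generalize hk : (PMF.pure M.start (x.2.1 0) *
    ∏ h : Fin H, π x.1 (x.2.1 h.castSucc) (x.2.2 h)).toReal = k
  have hk0 : 0 ≤ k := hk ▸ ENNReal.toReal_nonneg
  generalize hl : (lik M.trans x).toReal = l
  have hl0 : 0 ≤ l := hl ▸ ENNReal.toReal_nonneg
  generalize (lik P x).toReal = m
  rcases hl0.eq_or_lt with rfl | hl1
  · simp
  · have e : k * l * (k * m) = (k * l) ^ 2 * (m / l) := by field_simp
    rw [e, Real.sqrt_mul (sq_nonneg _), Real.sqrt_sq (by positivity)]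

theorem sum_ctxLaw (M : CMDP C S A H) : ∑ c, (M.ctxLaw c).toReal = 1 := by
  rw [← ENNReal.toReal_sum fun x _ => PMF.apply_ne_top _ _, sum_pmf_eq_one, ENNReal.toReal_one]

theorem one_sub_meanAffinity (M : CMDP C S A H) (π : C → Policy S A) (P : C → Dynamics S A) :
    1 - meanAffinity M π P =
      ∑ c, (M.ctxLaw c).toReal * (1 - affinity M.start H (π c) (M.trans c) (P c)) := by
  simp_rw [mul_sub, mul_one, Finset.sum_sub_distrib, sum_ctxLaw]
  rfl

variable [MeasurableSpace C] [MeasurableSingletonClass C]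
    [MeasurableSpace S] [MeasurableSingletonClass S]
    [MeasurableSpace A] [MeasurableSingletonClass A]

theorem measurable_path : Measurable (Episode.path : Episode C S A H → _) := by
  unfold Episode.path
  fun_prop

/-- The losses have probability laws and integrate out, leaving only context, states and actions. -/
theorem episodeLaw_path (M : CMDP C S A H) (π : C → Policy S A)
    (x : C × (Fin (H + 1) → S) × (Fin H → A)) :
    M.episodeLaw π (Episode.path ⁻¹' {x}) =
      M.ctxLaw x.1 * pathProb M.start (π x.1) (M.trans x.1) x.2.1 x.2.2 := by
  classical
  obtain ⟨c, s, a⟩ := x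
  have hm : ∀ c s a, Measurable (fun l => ((c, s, a, l) : Episode C S A H)) := fun c s a => by
    fun_prop
  have hE : MeasurableSet (Episode.path ⁻¹' {(c, s, a)} : Set (Episode C S A H)) :=
    measurable_path (measurableSet_singleton _)
  have hp : ∀ c s a, IsProbabilityMeasure (M.lossLaw c s a) := M.lossLaw_prob
  have h1 : ∀ c' s' a', ((Measure.pi fun h : Fin H => M.lossLaw c' (s' h.castSucc) (a' h)).map
        (fun l => ((c', s', a', l) : Episode C S A H))) (Episode.path ⁻¹' {(c, s, a)}) =
      if (c', s', a') = (c, s, a) then 1 else 0 := by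
    intro c' s' a'
    rw [Measure.map_apply (hm c' s' a') hE, ← Set.preimage_comp]
    have : (Episode.path ∘ fun l => ((c', s', a', l) : Episode C S A H)) =
      fun _ => (c', s', a') := rfl
    rw [this]
    split_ifs with h
    · rw [Set.preimage_const_of_mem (by simp [h]), measure_univ]
    · rw [Set.preimage_const_of_notMem (by simpa using h), measure_empty]
  simp only [CMDP.episodeLaw, Measure.coe_finsetSum, Finset.sum_apply, Measure.smul_apply, h1,
    smul_eq_mul, Prod.mk.injEq]
  rw [Finset.sum_eq_single c, Finset.sum_eq_single s, Finset.sum_eq_single a]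
  · simp [pathProb]
  · intro b _ hb; simp [hb]
  · simp
  · intro b _ hb; simp [hb]
  · simp
  · intro b _ hb; simp [hb]
  · simp

theorem sum_episodeLaw_mul_sqrtRatio (M : CMDP C S A H) (π : C → Policy S A)
    (P : C → Dynamics S A) :
    ∑ x, M.episodeLaw π (Episode.path ⁻¹' {x}) * ENNReal.ofReal (sqrtRatio M P x) =
      ENNReal.ofReal (meanAffinity M π P) := by
  have h1 : ∀ x, M.episodeLaw π (Episode.path ⁻¹' {x}) * ENNReal.ofReal (sqrtRatio M P x) =
      ENNReal.ofReal ((M.ctxLaw x.1).toReal *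
        √((pathProb M.start (π x.1) (M.trans x.1) x.2.1 x.2.2).toReal *
        (pathProb M.start (π x.1) (P x.1) x.2.1 x.2.2).toReal)) := by
    intro x
    rw [episodeLaw_path, ← toReal_pathProb_mul_sqrtRatio, ← mul_assoc,
      ENNReal.ofReal_mul (by positivity), ENNReal.ofReal_mul (by positivity),
      ENNReal.ofReal_toReal (PMF.apply_ne_top _ _), ENNReal.ofReal_toReal (pathProb_ne_top _ _ _ _ _)]
  simp_rw [h1]
  rw [← ENNReal.ofReal_sum_of_nonneg fun x _ => by positivity, Fintype.sum_prod_type]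
  simp_rw [← Finset.mul_sum]
  rfl

end Likelihood

/-! ### Adaptivity and the exponential supermartingale -/

section Run

variable {C S A : Type*} [Fintype C] [Fintype S] [Fintype A] [Nonempty A] {H : ℕ}
  [MeasurableSpace C] [MeasurableSingletonClass C]
  [MeasurableSpace S] [MeasurableSingletonClass S]
  [MeasurableSpace A] [MeasurableSingletonClass A]
  {F : Finset (C → S → A → ℝ)} {Pc : Finset (C → Dynamics S A)}
  {Ω : Type*} [mΩ : MeasurableSpace Ω]

/-- The information contained in the first `t` episodes. -/
abbrev history (σ : ℕ → Ω → Episode C S A H) (t : ℕ) : MeasurableSpace Ω :=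
  MeasurableSpace.comap (fun ω (i : Fin t) => σ i ω) inferInstance

theorem history_le {σ : ℕ → Ω → Episode C S A H} (hσ : ∀ t, Measurable (σ t)) (t : ℕ) :
    history σ t ≤ mΩ :=
  Measurable.comap_le (measurable_pi_lambda _ fun i => hσ i)

theorem measurable_history (σ : ℕ → Ω → Episode C S A H) {i t : ℕ} (h : i < t) :
    Measurable[history σ t] (σ i) :=
  (measurable_pi_apply (⟨i, h⟩ : Fin t)).comp (comap_measurable fun ω (i : Fin t) => σ i ω)

theorem measurable_history_pi (σ : ℕ → Ω → Episode C S A H) {k t : ℕ} (h : k ≤ t) :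
    Measurable[history σ t] (fun ω (i : Fin k) => σ i ω) :=
  (@measurable_pi_iff Ω (Fin k) _ (history σ t) _ _).2 fun i =>
    measurable_history σ (i.2.trans_le h)

/-- The policy of index `t` reads only estimates of index below `t`; this makes it a function of
finitely many oracle outputs. -/
theorem policySeq_congr (layer : S → Fin (H + 1)) (s₁ : S) (η βl βP : ℝ)
    {f f' : ℕ → S → A → ℝ} {P P' : ℕ → Dynamics S A} {t : ℕ} (hf : ∀ k < t, f k = f' k)
    (hP : ∀ k < t, P k = P' k) :
    policySeq layer s₁ η βl βP f P t = policySeq layer s₁ η βl βP f' P' t := by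
  induction t using Nat.strong_induction_on with
  | _ t ih =>
    cases t with
    | zero => rw [policySeq, policySeq]
    | succ k =>
      have e : ∀ i < k + 1, policySeq layer s₁ η βl βP f P i =
          policySeq layer s₁ η βl βP f' P' i := fun i hi =>
        ih i hi (fun j hj => hf j (hj.trans hi)) (fun j hj => hP j (hj.trans hi))
      have e' : (fun i : Fin k => policySeq layer s₁ η βl βP f P i) =
          fun i : Fin k => policySeq layer s₁ η βl βP f' P' i :=
        funext fun i => e i (by omega)
      rw [policySeq, policySeq]
      simp only [e', e k (by omega), hf k (by omega), hP k (by omega)]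

/-- The policy factors through the tuple of oracle outputs, which lives in a finite discrete space
because `F` and `Pc` are finite. Hence `G` may be arbitrary and no σ-algebra on policies is needed.
-/
theorem measurable_comp_policy (M : CMDP C S A H) (I : Params C S A H F Pc)
    (σ : ℕ → Ω → Episode C S A H) {t u : ℕ} (htu : t ≤ u) {β : Type*} [MeasurableSpace β]
    (G : (C → Policy S A) → β) :
    Measurable[history σ u] fun ω => G (I.policy M (fun i => σ i ω) t) := by
  let V := Fin t → F × Pc
  let _ : MeasurableSpace V := ⊤
  let v : Ω → V := fun ω k => (⟨I.fhat (fun i => σ i ω) k, I.lsOracle.run_mem _ _⟩,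
    ⟨I.Phat (fun i => σ i ω) k, I.logOracle.run_mem _ _⟩)
  have hv : Measurable[history σ u] v := by
    refine @measurable_to_countable' V Ω _ _ (history σ u) v fun x => ?_
    have : v ⁻¹' {x} = ⋂ k : Fin t,
        ((fun ω (i : Fin k) => σ i ω) ⁻¹' {D | I.lsOracle.run k D = (x k).1.1}) ∩
        ((fun ω (i : Fin k) => σ i ω) ⁻¹' {D | I.logOracle.run k D = (x k).2.1}) := by
      ext ω
      simp only [Set.mem_preimage, Set.mem_singleton_iff, Set.mem_iInter, Set.mem_inter_iff,
        Set.mem_ofPred_eq]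
      rw [funext_iff]
      exact forall_congr' fun k => by rw [Prod.ext_iff, Subtype.ext_iff, Subtype.ext_iff]; rfl
    rw [this]
    refine MeasurableSet.iInter fun k => MeasurableSet.inter ?_ ?_
    · exact measurable_history_pi σ (k.2.le.trans htu) (I.lsOracle.measurable_run _ _)
    · exact measurable_history_pi σ (k.2.le.trans htu) (I.logOracle.measurable_run _ _)
  -- The values at indices `k ≥ t` are placeholders that the policy of index `t` never reads.
  let Φ : V → C → Policy S A := fun x c => policySeq M.layer M.start I.η I.βl I.βP
    (fun k => if h : k < t then (x ⟨k, h⟩).1.1 c else 0)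
    (fun k => if h : k < t then (x ⟨k, h⟩).2.1 c else M.trans c) t
  have hΦ : (fun ω => G (I.policy M (fun i => σ i ω) t)) = (G ∘ Φ) ∘ v := by
    funext ω
    refine congrArg G (funext fun c => ?_)
    exact policySeq_congr _ _ _ _ _ (fun k hk => by simp [v, hk]) (fun k hk => by simp [v, hk])
  rw [hΦ]
  exact measurable_from_top.comp hv

variable {μ : Measure Ω} {M : CMDP C S A H} {I : Params C S A H F Pc} {T : ℕ}
  {σ : ℕ → Ω → Episode C S A H}

/-- Extends the defining identity of a run from past events to past-measurable weights: the
restriction to the event of round `t` and the density given by its conditional probability agree on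
the history σ-algebra. -/
theorem IsRun.setLIntegral_eq [IsProbabilityMeasure μ] (hσ : IsRun μ M I T σ) {t : ℕ} (ht : t < T)
    {Y : Ω → ℝ≥0∞} (hY : Measurable[history σ t] Y) {E : Set (Episode C S A H)}
    (hE : MeasurableSet E) :
    ∫⁻ ω in σ t ⁻¹' E, Y ω ∂μ =
      ∫⁻ ω, M.episodeLaw (I.policy M (fun i => σ i ω) t) E * Y ω ∂μ := by
  have hle := history_le hσ.measurable t
  have hK := (measurable_comp_policy M I σ le_rfl (t := t) fun π => M.episodeLaw π E).mono hle le_rfl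
  have h1 : (μ.restrict (σ t ⁻¹' E)).trim hle =
      (μ.withDensity fun ω => M.episodeLaw (I.policy M (fun i => σ i ω) t) E).trim hle := by
    refine @Measure.ext _ (history σ t) _ _ fun s hs => ?_
    rw [trim_measurableSet_eq hle hs, trim_measurableSet_eq hle hs,
      Measure.restrict_apply (hle s hs), withDensity_apply _ (hle s hs)]
    obtain ⟨B, hB, rfl⟩ := hs
    exact hσ.law t ht B hB E hE
  rw [← lintegral_trim hle hY, h1, lintegral_trim hle hY,
    lintegral_withDensity_eq_lintegral_mul _ hK (hY.mono hle le_rfl)]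
  rfl

/-- The conditional mean of the square-root ratio is the affinity. Path space is finite, so the
integral splits over the atoms of the path and no conditional kernel has to be constructed. -/
theorem IsRun.lintegral_mul_sqrtRatio [IsProbabilityMeasure μ] (hσ : IsRun μ M I T σ) {t : ℕ}
    (ht : t < T) {Y : Ω → ℝ≥0∞} (hY : Measurable[history σ t] Y) (P : C → Dynamics S A) :
    ∫⁻ ω, Y ω * ENNReal.ofReal (sqrtRatio M P (σ t ω).path) ∂μ =
      ∫⁻ ω, Y ω * ENNReal.ofReal (meanAffinity M (I.policy M (fun i => σ i ω) t) P) ∂μ := by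
  classical
  have hle := history_le hσ.measurable t
  have hY' := hY.mono hle le_rfl
  have hE : ∀ x, MeasurableSet (Episode.path ⁻¹' {x} : Set (Episode C S A H)) := fun x =>
    measurable_path (measurableSet_singleton _)
  have hK : ∀ x, Measurable fun ω => M.episodeLaw (I.policy M (fun i => σ i ω) t)
      (Episode.path ⁻¹' {x}) := fun x =>
    (measurable_comp_policy M I σ le_rfl (t := t) fun π => M.episodeLaw π _).mono hle le_rfl
  calc _ = ∫⁻ ω, ∑ x, ENNReal.ofReal (sqrtRatio M P x) *
        (σ t ⁻¹' (Episode.path ⁻¹' {x})).indicator Y ω ∂μ := by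
        refine lintegral_congr fun ω => ?_
        rw [Finset.sum_eq_single (σ t ω).path]
        · simp [mul_comm]
        · intro x _ hx
          simp [Set.indicator, hx.symm]
        · simp
    _ = ∑ x, ENNReal.ofReal (sqrtRatio M P x) *
        ∫⁻ ω, M.episodeLaw (I.policy M (fun i => σ i ω) t) (Episode.path ⁻¹' {x}) * Y ω ∂μ := by
        have hm : ∀ x, Measurable ((σ t ⁻¹' (Episode.path ⁻¹' {x})).indicator Y) := fun x =>
          hY'.indicator (hσ.measurable t (hE x))
        rw [lintegral_finsetSum _ fun x _ => (hm x).const_mul _]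
        refine Finset.sum_congr rfl fun x _ => ?_
        rw [lintegral_const_mul _ (hm x), lintegral_indicator (hσ.measurable t (hE x)),
          hσ.setLIntegral_eq ht hY (hE x)]
    _ = _ := by
        simp_rw [← sum_episodeLaw_mul_sqrtRatio, Finset.mul_sum]
        rw [lintegral_finsetSum _ fun x _ => by exact hY'.mul ((hK x).mul_const _)]
        refine Finset.sum_congr rfl fun x _ => ?_
        rw [← lintegral_const_mul _ (by exact (hK x).mul hY')]
        refine lintegral_congr fun ω => ?_
        ring

/-- The exponential supermartingale comparing the likelihood of `P` with that of the true
dynamics. -/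
def likProcess (M : CMDP C S A H) (I : Params C S A H F Pc) (σ : ℕ → Ω → Episode C S A H)
    (P : C → Dynamics S A) (t : ℕ) (ω : Ω) : ℝ≥0∞ :=
  ∏ i ∈ Finset.range t, (ENNReal.ofReal (Real.exp (1 - meanAffinity M
    (I.policy M (fun j => σ j ω) i) P)) * ENNReal.ofReal (sqrtRatio M P (σ i ω).path))

theorem measurable_likProcess (P : C → Dynamics S A) (t : ℕ) :
    Measurable[history σ t] (likProcess M I σ P t) := by
  refine Finset.measurable_fun_prod _ fun i hi => ?_
  have hi := Finset.mem_range.1 hi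
  refine Measurable.mul (measurable_comp_policy M I σ hi.le
    fun π => ENNReal.ofReal (Real.exp (1 - meanAffinity M π P))) ?_
  have : Measurable fun x : C × (Fin (H + 1) → S) × (Fin H → A) =>
    ENNReal.ofReal (sqrtRatio M P x) := measurable_of_finite _
  exact this.comp (measurable_path.comp (measurable_history σ hi))

theorem IsRun.lintegral_likProcess_le [IsProbabilityMeasure μ] (hσ : IsRun μ M I T σ)
    (P : C → Dynamics S A) {t : ℕ} (ht : t ≤ T) : ∫⁻ ω, likProcess M I σ P t ω ∂μ ≤ 1 := by
  induction t with
  | zero => simp [likProcess]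
  | succ t ih =>
    refine le_trans ?_ (ih (by omega))
    have h1 : ∀ ω, likProcess M I σ P (t + 1) ω = (likProcess M I σ P t ω *
        ENNReal.ofReal (Real.exp (1 - meanAffinity M (I.policy M (fun j => σ j ω) t) P))) *
        ENNReal.ofReal (sqrtRatio M P (σ t ω).path) := fun ω => by
      rw [likProcess, Finset.prod_range_succ, ← mul_assoc]
      rfl
    simp_rw [h1]
    have hY : Measurable[history σ t] fun ω => likProcess M I σ P t ω *
        ENNReal.ofReal (Real.exp (1 - meanAffinity M (I.policy M (fun j => σ j ω) t) P)) :=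
      (measurable_likProcess P t).mul (measurable_comp_policy M I σ le_rfl
        fun π => ENNReal.ofReal (Real.exp (1 - meanAffinity M π P)))
    rw [hσ.lintegral_mul_sqrtRatio ht hY]
    refine lintegral_mono fun ω => ?_
    rw [mul_assoc, ← ENNReal.ofReal_mul (Real.exp_pos _).le]
    refine mul_le_of_le_one_right zero_le ?_
    rw [ENNReal.ofReal_le_one]
    set r := meanAffinity M (I.policy M (fun j => σ j ω) t) P
    -- The supermartingale inequality reduces to r ≤ exp(r - 1).
    calc Real.exp (1 - r) * r ≤ Real.exp (1 - r) * Real.exp (r - 1) :=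
          mul_le_mul_of_nonneg_left (by linarith [Real.add_one_le_exp (r - 1)]) (Real.exp_pos _).le
      _ = 1 := by rw [← Real.exp_add]; simp

/-- Ensures that the likelihood ratios along the observed data have nonzero denominators almost
surely. -/
theorem IsRun.ae_lik_ne_zero [IsProbabilityMeasure μ] (hσ : IsRun μ M I T σ) :
    ∀ᵐ ω ∂μ, ∀ t < T, lik M.trans (σ t ω).path ≠ 0 := by
  rw [ae_all_iff]
  intro t
  by_cases ht : t < T
  · have hE : ∀ x, MeasurableSet (Episode.path ⁻¹' {x} : Set (Episode C S A H)) := fun x =>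
      measurable_path (measurableSet_singleton _)
    have h1 : ∀ x : C × (Fin (H + 1) → S) × (Fin H → A), ∀ᵐ ω ∂μ,
        lik M.trans x = 0 → (σ t ω).path ≠ x := by
      intro x
      by_cases hx : lik M.trans x = 0
      · have := hσ.setLIntegral_eq ht (Y := fun _ => 1) measurable_const (hE x)
        simp only [episodeLaw_path, pathProb_eq_mul_lik, hx, mul_zero, zero_mul, lintegral_zero,
          lintegral_const, one_mul, Measure.restrict_apply MeasurableSet.univ,
          Set.univ_inter] at this
        rw [ae_iff]
        simp only [hx, forall_const, not_not]
        exact this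
      · simp [hx]
    filter_upwards [ae_all_iff.2 h1] with ω hω _ h0
    exact hω _ h0 rfl
  · simp [ht]

end Run

/-! ### Maximum likelihood guarantee and the expected bonus -/

section Guarantee

variable {C S A : Type*} [Fintype C] [Fintype S] [Fintype A] [Nonempty A] {H : ℕ}
  [MeasurableSpace C] [MeasurableSingletonClass C]
  [MeasurableSpace S] [MeasurableSingletonClass S]
  [MeasurableSpace A] [MeasurableSingletonClass A]
  {F : Finset (C → S → A → ℝ)} {Pc : Finset (C → Dynamics S A)}
  {Ω : Type*} [MeasurableSpace Ω]
  {μ : Measure Ω} {M : CMDP C S A H} {I : Params C S A H F Pc} {T : ℕ}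
  {σ : ℕ → Ω → Episode C S A H}

theorem sqrtRatio_nonneg (M : CMDP C S A H) (P : C → Dynamics S A)
    (x : C × (Fin (H + 1) → S) × (Fin H → A)) : 0 ≤ sqrtRatio M P x := Real.sqrt_nonneg _

/-- The true dynamics compete in the maximization, so the estimate has at least their likelihood on
the data. -/
theorem one_le_prod_sqrtRatio (htrans : M.trans ∈ Pc) (I : Params C S A H F Pc) {t : ℕ}
    (e : ℕ → Episode C S A H) (h0 : ∀ i < t, lik M.trans (e i).path ≠ 0) :
    1 ≤ ∏ i ∈ Finset.range t, sqrtRatio M (I.Phat e t) (e i).path := by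
  have h1 := I.logOracle.run_max t (fun i => e i) _ htrans
  rw [logLik_eq, logLik_eq, ENNReal.log_le_log_iff] at h1
  have h2 := ENNReal.toReal_mono (ENNReal.prod_ne_top fun _ _ => lik_ne_top _ _) h1
  rw [ENNReal.toReal_prod, ENNReal.toReal_prod] at h2
  unfold sqrtRatio
  rw [← Real.sqrt_prod _ fun _ _ => by positivity, Real.one_le_sqrt, Finset.prod_div_distrib,
    one_le_div₀ (Finset.prod_pos fun i hi => ENNReal.toReal_pos (h0 i (Finset.mem_range.1 hi))
      (lik_ne_top _ _)), Finset.prod_range, Finset.prod_range]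
  exact h2

theorem sum_one_sub_meanAffinity_le (htrans : M.trans ∈ Pc) {t : ℕ} {ω : Ω} {B : ℝ}
    (h0 : ∀ i < t, lik M.trans (σ i ω).path ≠ 0)
    (hB : likProcess M I σ (I.Phat (fun i => σ i ω) t) t ω < ENNReal.ofReal B) :
    ∑ i ∈ Finset.range t, (1 - meanAffinity M (I.policy M (fun j => σ j ω) i)
      (I.Phat (fun j => σ j ω) t)) ≤ Real.log B := by
  have h1 := one_le_prod_sqrtRatio htrans I (fun i => σ i ω) h0
  have hB0 : 0 < B := ENNReal.ofReal_pos.1 (pos_of_gt hB)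
  rw [Real.le_log_iff_exp_le hB0, Real.exp_sum]
  unfold likProcess at hB
  simp_rw [← ENNReal.ofReal_mul (Real.exp_pos _).le] at hB
  rw [← ENNReal.ofReal_prod_of_nonneg fun i _ =>
      mul_nonneg (Real.exp_pos _).le (sqrtRatio_nonneg M _ _), ENNReal.ofReal_lt_ofReal_iff hB0,
    Finset.prod_mul_distrib] at hB
  -- The ratio factor is at least 1, so the exponential factor alone stays below `B`.
  exact (le_mul_of_one_le_right (Finset.prod_nonneg fun _ _ => (Real.exp_pos _).le) h1).trans hB.le

theorem expectedBonus_le_of_sum_le (hH : 1 ≤ H) {β₀ L : ℝ} (hβ₀ : 1 ≤ β₀) (hl : β₀ ≤ I.βl)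
    (hP : β₀ ≤ I.βP) (hL : 0 ≤ L) (e : ℕ → Episode C S A H)
    (h : ∀ t ∈ Finset.Ico 1 T, ∑ i ∈ Finset.range t,
      (1 - meanAffinity M (I.policy M e i) (I.Phat e t)) ≤ L) :
    I.expectedBonus M T e ≤
      4 * (I.βl + 2 * H * I.βP) * Fintype.card S * Fintype.card A * Real.log ((T : ℝ) + 1) +
        24 * T * (H : ℝ) ^ 2 * L / β₀ := by
  unfold Params.expectedBonus Params.bonus
  refine (Finset.sum_le_sum fun c _ => mul_le_mul_of_nonneg_left
    (sum_occ_mul_bonus_le M.layer M.start hH hβ₀ hl hP T (fun t => I.policy M e t c) (M.trans c)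
      fun t => I.Phat e t c) ENNReal.toReal_nonneg).trans ?_
  simp_rw [mul_add, Finset.sum_add_distrib]
  refine add_le_add (le_of_eq ?_) ?_
  · rw [← Finset.sum_mul, sum_ctxLaw, one_mul]
  -- Averaging over contexts turns affinities into `meanAffinity`; the factor 2 of the Hellinger
  -- bound makes 12 into 24.
  · have e1 : ∑ c, (M.ctxLaw c).toReal * (12 * (H : ℝ) ^ 2 / β₀ * ∑ t ∈ Finset.Ico 1 T,
          ∑ i : Fin t, 2 * (1 - affinity M.start H (I.policy M e i c) (M.trans c)
            (I.Phat e t c))) =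
        24 * (H : ℝ) ^ 2 / β₀ * ∑ t ∈ Finset.Ico 1 T, ∑ i ∈ Finset.range t,
          (1 - meanAffinity M (I.policy M e i) (I.Phat e t)) := by
      simp_rw [one_sub_meanAffinity, Finset.sum_range, Finset.mul_sum]
      rw [Finset.sum_comm]
      refine Finset.sum_congr rfl fun t _ => ?_
      rw [Finset.sum_comm]
      refine Finset.sum_congr rfl fun i _ => Finset.sum_congr rfl fun c _ => ?_
      ring
    rw [e1]
    have e2 : ∑ t ∈ Finset.Ico 1 T, ∑ i ∈ Finset.range t,
        (1 - meanAffinity M (I.policy M e i) (I.Phat e t)) ≤ T * L := by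
      refine (Finset.sum_le_sum h).trans ?_
      rw [Finset.sum_const, Nat.card_Ico, nsmul_eq_mul]
      exact mul_le_mul_of_nonneg_right (by exact_mod_cast Nat.sub_le _ _) hL
    refine (mul_le_mul_of_nonneg_left e2 (by positivity)).trans (le_of_eq ?_)
    ring

theorem expectedBonus_le (hH : 1 ≤ H) (e : ℕ → Episode C S A H) :
    I.expectedBonus M T e ≤ 3 * T * (H : ℝ) ^ 2 := by
  have h1 : ∀ c, ∑ t ∈ Finset.Ico 1 T, ∑ h : Fin H, ∑ s with M.layer s = h.castSucc, ∑ a : A,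
      occ M.start h s a (I.policy M e t c) (M.trans c) *
        (I.bonus M e I.βl t c s a + 2 * (H : ℝ) * I.bonus M e I.βP t c s a) ≤
      3 * T * (H : ℝ) ^ 2 := by
    intro c
    refine (Finset.sum_le_sum fun t _ => sum_occ_mul_le M.layer M.start _ _ hH fun s a =>
      add_le_add (bonusOf_le_one ..) (mul_le_of_le_one_right (by positivity)
        (bonusOf_le_one ..))).trans ?_
    rw [Finset.sum_const, Nat.card_Ico, nsmul_eq_mul]
    have : ((T - 1 : ℕ) : ℝ) ≤ T := by exact_mod_cast Nat.sub_le _ _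
    nlinarith [sq_nonneg (H : ℝ)]
  refine (Finset.sum_le_sum fun c _ => mul_le_mul_of_nonneg_left (h1 c)
    ENNReal.toReal_nonneg).trans (le_of_eq ?_)
  rw [← Finset.sum_mul, sum_ctxLaw, one_mul]

/-- Markov's inequality for each pair of round and model. The union over `Pc` is needed because the
estimate is chosen from the same data. -/
theorem IsRun.measure_exists_le_likProcess_le [IsProbabilityMeasure μ] (hσ : IsRun μ M I T σ)
    {B : ℝ} (hB : 0 < B) :
    μ {ω | ∃ t ∈ Finset.Ico 1 T, ∃ P ∈ Pc, ENNReal.ofReal B ≤ likProcess M I σ P t ω} ≤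
      ENNReal.ofReal (T * Pc.card / B) := by
  have h1 : ∀ t ∈ Finset.Ico 1 T, ∀ P ∈ Pc,
      μ {ω | ENNReal.ofReal B ≤ likProcess M I σ P t ω} ≤ ENNReal.ofReal (1 / B) := by
    intro t ht P _
    have hm := (measurable_likProcess (M := M) (I := I) (σ := σ) P t).mono
      (history_le hσ.measurable t) le_rfl
    refine (meas_ge_le_lintegral_div hm.aemeasurable (ENNReal.ofReal_pos.2 hB).ne'
      ENNReal.ofReal_ne_top).trans ?_
    rw [ENNReal.ofReal_div_of_pos hB, ENNReal.ofReal_one]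
    exact ENNReal.div_le_div_right
      (hσ.lintegral_likProcess_le P (Finset.mem_Ico.1 ht).2.le) _
  have h2 : {ω | ∃ t ∈ Finset.Ico 1 T, ∃ P ∈ Pc, ENNReal.ofReal B ≤ likProcess M I σ P t ω} =
      ⋃ t ∈ Finset.Ico 1 T, ⋃ P ∈ Pc, {ω | ENNReal.ofReal B ≤ likProcess M I σ P t ω} := by
    ext ω
    simp
  rw [h2]
  refine (measure_biUnion_finset_le _ _).trans ?_
  refine (Finset.sum_le_sum fun t ht => (measure_biUnion_finset_le _ _).trans
    (Finset.sum_le_sum (h1 t ht))).trans ?_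
  rw [Finset.sum_const, Finset.sum_const, Nat.card_Ico, nsmul_eq_mul, nsmul_eq_mul,
    ← ENNReal.ofReal_natCast, ← ENNReal.ofReal_natCast, ← ENNReal.ofReal_mul (by positivity),
    ← ENNReal.ofReal_mul (by positivity)]
  refine ENNReal.ofReal_le_ofReal ?_
  rw [← mul_assoc, mul_one_div]
  gcongr
  exact Nat.sub_le _ _

end Guarantee

end

end OPO

/-! ### The high-probability bound -/

theorem lemma2 {C S A : Type*} [Fintype C] [Fintype S] [Fintype A] [Nonempty A]
    [MeasurableSpace C] [MeasurableSingletonClass C]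
    [MeasurableSpace S] [MeasurableSingletonClass S]
    [MeasurableSpace A] [MeasurableSingletonClass A]
    (H T : ℕ) (hH : 1 ≤ H) (hT : 1 ≤ T)
    (M : OPO.CMDP C S A H)
    (F : Finset (C → S → A → ℝ)) (Pc : Finset (C → OPO.Dynamics S A))
    (hF : ∀ f ∈ F, ∀ c s a, f c s a ∈ Set.Icc (0 : ℝ) 1)
    (hPc : ∀ P ∈ Pc, ∀ c, OPO.RespectsLayers M.layer (P c))
    (hloss : M.loss ∈ F) (htrans : M.trans ∈ Pc)
    (I : OPO.Params C S A H F Pc) (hβl : 0 < I.βl) (hβP : 0 < I.βP)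
    {Ω : Type*} [MeasurableSpace Ω] (μ : MeasureTheory.Measure Ω)
    [MeasureTheory.IsProbabilityMeasure μ]
    (σ : ℕ → Ω → OPO.Episode C S A H) (hσ : OPO.IsRun μ M I T σ)
    (δ : ℝ) (hδ0 : 0 < δ) (hδ1 : δ < 1) :
    ENNReal.ofReal (1 - δ / 4) ≤
      μ {ω | I.expectedBonus M T (fun t => σ t ω) ≤
        5184 * (T : ℝ) * (H : ℝ) ^ 7 * Real.log (4 * T * H * (Pc.card : ℝ) / δ)
            / min I.βP I.βl
          + 7 * (I.βl + 2 * H * I.βP) * Fintype.card S * Fintype.card A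
            * Real.log ((T : ℝ) + 1)} := by
  have hH' : (1 : ℝ) ≤ H := by exact_mod_cast hH
  have hT' : (1 : ℝ) ≤ T := by exact_mod_cast hT
  have hN : (1 : ℝ) ≤ Pc.card := by exact_mod_cast Finset.card_pos.2 ⟨_, htrans⟩
  have hβ0 : 0 < min I.βP I.βl := lt_min hβP hβl
  have hHpow : (H : ℝ) ^ 2 ≤ (H : ℝ) ^ 7 := pow_le_pow_right₀ hH' (by norm_num)
  have hTN : 1 ≤ (T : ℝ) * Pc.card := one_le_mul_of_one_le_of_one_le hT' hN
  have hB4 : 4 ≤ 4 * T * (Pc.card : ℝ) / δ := by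
    rw [le_div_iff₀ hδ0]
    nlinarith
  have hBH : 4 * T * (Pc.card : ℝ) / δ ≤ 4 * T * H * (Pc.card : ℝ) / δ := by
    rw [div_le_div_iff_of_pos_right hδ0]
    exact mul_le_mul_of_nonneg_right (le_mul_of_one_le_right (by positivity) hH') (by positivity)
  -- Uses B ≥ 4 > e. The bound 1 ≤ log B lets the logarithmic term absorb the trivial bound when β₀
  -- ≤ 1.
  have hL1 : 1 ≤ Real.log (4 * T * (Pc.card : ℝ) / δ) := by
    rw [Real.le_log_iff_exp_le (by linarith)]
    linarith [Real.exp_one_lt_d9]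
  have hL2 : Real.log (4 * T * (Pc.card : ℝ) / δ) ≤ Real.log (4 * T * H * (Pc.card : ℝ) / δ) :=
    Real.log_le_log (by linarith) hBH
  have hlogT : 0 ≤ (I.βl + 2 * H * I.βP) * Fintype.card S * Fintype.card A *
      Real.log ((T : ℝ) + 1) :=
    mul_nonneg (by positivity) (Real.log_nonneg (by linarith))
  have hbad := hσ.measure_exists_le_likProcess_le (B := 4 * T * (Pc.card : ℝ) / δ) (by linarith)
  -- This choice of threshold makes the failure probability T|Pc|/B exactly δ/4.
  have hδ : (T : ℝ) * Pc.card / (4 * T * (Pc.card : ℝ) / δ) = δ / 4 := by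
    field_simp
  rw [hδ] at hbad
  set B := 4 * T * (Pc.card : ℝ) / δ
  set L := Real.log (4 * T * H * (Pc.card : ℝ) / δ)
  set β₀ := min I.βP I.βl
  have hgood : ∀ᵐ ω ∂μ, ω ∉ {ω | ∃ t ∈ Finset.Ico 1 T, ∃ P ∈ Pc,
      ENNReal.ofReal B ≤ OPO.likProcess M I σ P t ω} →
      I.expectedBonus M T (fun t => σ t ω) ≤ 5184 * (T : ℝ) * (H : ℝ) ^ 7 * L / β₀ +
        7 * (I.βl + 2 * H * I.βP) * Fintype.card S * Fintype.card A * Real.log ((T : ℝ) + 1) := by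
    filter_upwards [hσ.ae_lik_ne_zero] with ω h0 hω
    have hω' : ∀ t ∈ Finset.Ico 1 T, ∀ P ∈ Pc,
        OPO.likProcess M I σ P t ω < ENNReal.ofReal B := fun t ht P hP =>
      not_le.1 fun h => hω ⟨t, ht, P, hP, h⟩
    rcases le_total 1 β₀ with hβ | hβ
    · refine (OPO.expectedBonus_le_of_sum_le hH hβ (min_le_right _ _) (min_le_left _ _)
        (by linarith : 0 ≤ L) _ fun t ht => ?_).trans ?_
      · have htT := (Finset.mem_Ico.1 ht).2
        exact (OPO.sum_one_sub_meanAffinity_le htrans (fun i hi => h0 i (hi.trans htT))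
          (hω' t ht _ (I.logOracle.run_mem _ _))).trans hL2
      · have h1 : 24 * T * (H : ℝ) ^ 2 * L / β₀ ≤ 5184 * (T : ℝ) * (H : ℝ) ^ 7 * L / β₀ := by
          have : 0 ≤ L := by linarith
          gcongr
          norm_num
        linarith
    · refine (OPO.expectedBonus_le hH _).trans ?_
      have h1 : 3 * T * (H : ℝ) ^ 2 ≤ 5184 * (T : ℝ) * (H : ℝ) ^ 7 * L / β₀ := by
        rw [le_div_iff₀ hβ0]
        calc 3 * T * (H : ℝ) ^ 2 * β₀ ≤ 3 * T * (H : ℝ) ^ 2 * 1 := by gcongr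
          _ ≤ 5184 * T * (H : ℝ) ^ 7 * 1 := by gcongr; norm_num
          _ ≤ _ := by gcongr; linarith
      linarith
  -- Covering the space by the bad event and the target event avoids proving that the target event
  -- is measurable.
  have hcover : 1 ≤ ENNReal.ofReal (δ / 4) + μ {ω | I.expectedBonus M T (fun t => σ t ω) ≤
      5184 * (T : ℝ) * (H : ℝ) ^ 7 * L / β₀ +
        7 * (I.βl + 2 * H * I.βP) * Fintype.card S * Fintype.card A * Real.log ((T : ℝ) + 1)} := by
    rw [← MeasureTheory.measure_univ (μ := μ)]
    refine le_trans ?_ ((MeasureTheory.measure_union_le _ _).trans (add_le_add_left hbad _))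
    refine MeasureTheory.measure_mono_ae ?_
    filter_upwards [hgood] with ω hω _
    exact or_iff_not_imp_left.2 hω
  rw [ENNReal.ofReal_sub _ (by positivity), ENNReal.ofReal_one]
  exact tsub_le_iff_left.2 hcover
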